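/- Let $K$ be a nonempty compact metric space, let $h:K\to K$ be a homeomorphism, and let $C^0(K)$ be the space of continuous functions $K\to\mathbb{R}$ with the supremum norm. Let $\mathcal M_{inv}(h)$ and $\mathcal M_{erg}(h)$ be the sets of $h$-invariant, respectively ergodic, Borel probability measures on $K$, with the weak-$*$ topology, and let $h_\mu(h)\in[0,\infty]$ be the metric (Kolmogorov–Sinai) entropy of $\mu\in\mathcal M_{inv}(h)$. For $\varphi\in C^0(K)$ let $\mathcal M_{max}(\varphi)$ be the set of all $\mu\in\mathcal M_{inv}(h)$ with $\int\varphi\,d\mu=\sup_{\nu\in\mathcal M_{inv}(h)}\int\varphi\,d\nu$. A periodic measure is a measure $\frac1n\sum_{i=0}^{n-1}\delta_{h^i(x)}$, where $x$ is a periodic point of $h$ with minimal period $n\geq 1$. A residual subset means a dense $G_\delta$ subset. Consider the following properties of $h$. - $\mathcal P_e^+$: every $\mu\in\mathcal M_{erg}(h)$ with $h_\mu(h)>0$ is a weak-$*$ limit of periodic measures. - $\mathcal S$: whenever a sequence $(\mu_n)$ in $\mathcal M_{inv}(h)$ converges to $\mu$, one has $h_\mu(h)\ge\limsup_{n\to\infty}h_{\mu_n}(h)$.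 - $\mathcal F_s$: there is a dense $G_\delta$ subset $\mathcal M_R$ of $\overline{\mathcal M_{erg}(h)}$ such that every $\mu\in\mathcal M_R$ has support $K$. Then: 1. There is a residual subset $\mathcal R_1$ of $C^0(K)$ such that for each $\varphi\in\mathcal R_1$ the set $\mathcal M_{max}(\varphi)$ consists of exactly one measure. 2. If $h$ has the properties $\mathcal P_e^+$ and $\mathcal S$, then there is a residual subset $\mathcal R_2$ of $C^0(K)$ such that for each $\varphi\in\mathcal R_2$ the set $\mathcal M_{max}(\varphi)$ consists of exactly one measure, and this measure has zero entropy. 3. If $h$ has the property $\mathcal F_s$, then there is a residual subset $\mathcal R_3$ of $C^0(K)$ such that for each $\varphi\in\mathcal R_3$ the set $\mathcal M_{max}(\varphi)$ consists of exactly one measure, and this measure has support $K$. -/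

import Mathlib

open MeasureTheory Filter Topology
open scoped ENNReal

noncomputable section

namespace ErgodicOptimization

/-- The invariant Borel probability measures of `h`. -/
def invariantMeasures {K : Type*} [MeasurableSpace K] (h : K → K) :
    Set (ProbabilityMeasure K) :=
  {μ | MeasurePreserving h (μ : Measure K) (μ : Measure K)}

/-- The ergodic (invariant) Borel probability measures of `h`. -/
def ergodicMeasures {K : Type*} [MeasurableSpace K] (h : K → K) :
    Set (ProbabilityMeasure K) :=
  {μ | Ergodic h (μ : Measure K)}

/-- The supremum `β(φ)` of `∫ φ dν` over all invariant probability measures `ν`. -/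
def maxIntegral {K : Type*} [TopologicalSpace K] [MeasurableSpace K]
    (h : K → K) (φ : C(K, ℝ)) : ℝ :=
  ⨆ ν : invariantMeasures h, ∫ x, φ x ∂((ν : ProbabilityMeasure K) : Measure K)

/-- The maximizing measures of `φ`: the invariant probability measures attaining `β(φ)`. -/
def maximizingMeasures {K : Type*} [TopologicalSpace K] [MeasurableSpace K]
    (h : K → K) (φ : C(K, ℝ)) : Set (ProbabilityMeasure K) :=
  {μ | μ ∈ invariantMeasures h ∧ maxIntegral h φ = ∫ x, φ x ∂(μ : Measure K)}

/-- The measures equidistributed on a periodic orbit of `h`. -/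
def periodicMeasures {K : Type*} [MeasurableSpace K] (h : K → K) :
    Set (ProbabilityMeasure K) :=
  {μ | ∃ x ∈ Function.periodicPts h,
    (μ : Measure K) = (Function.minimalPeriod h x : ℝ≥0∞)⁻¹ •
      ∑ i ∈ Finset.range (Function.minimalPeriod h x), Measure.dirac (h^[i] x)}

/-- The Shannon entropy `-∑ μ(A) log μ(A)` of the finite partition into the fibres of `ξ`
(empty fibres contribute `0`). -/
def partitionEntropy {K ι : Type*} [MeasurableSpace K] [Fintype ι]
    (μ : Measure K) (ξ : K → ι) : ℝ :=
  ∑ a, Real.negMulLog (μ.real (ξ ⁻¹' {a}))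

/-- The labelling whose fibres form the join of the partitions `h⁻ⁱ ξ`, `0 ≤ i < n`. -/
def itinerary {K ι : Type*} (h : K → K) (ξ : K → ι) (n : ℕ) : K → (Fin n → ι) :=
  fun x i => ξ (h^[(i : ℕ)] x)

/-- The Kolmogorov-Sinai entropy of `h` with respect to a partition, i.e. the limit of
`H(⋁_{i<n} h⁻ⁱ ξ) / n`. For invariant `μ` the limit exists by subadditivity, hence equals
the upper limit used here. -/
def entropyOfPartition {K ι : Type*} [MeasurableSpace K] [Fintype ι]
    (h : K → K) (μ : Measure K) (ξ : K → ι) : ℝ≥0∞ :=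
  limsup (fun n : ℕ => ENNReal.ofReal (partitionEntropy μ (itinerary h ξ n) / n)) atTop

/-- The metric (Kolmogorov-Sinai) entropy of `h` with respect to `μ`, with values in `[0, ∞]`:
the supremum over all finite measurable partitions. -/
def metricEntropy {K : Type*} [MeasurableSpace K] (h : K → K) (μ : Measure K) : ℝ≥0∞ :=
  ⨆ (k : ℕ) (ξ : K → Fin k) (_ : Measurable ξ), entropyOfPartition h μ ξ

/-- Property `P_e^+`: each ergodic measure with positive metric entropy is approximated, in the
weak-* topology, by periodic measures. -/
def PropertyPePlus {K : Type*} [TopologicalSpace K] [MeasurableSpace K]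
    [OpensMeasurableSpace K] (h : K → K) : Prop :=
  ∀ μ ∈ ergodicMeasures h, 0 < metricEntropy h (μ : Measure K) →
    μ ∈ closure (periodicMeasures h)

/-- Property `S`: the metric entropy is upper semicontinuous along weak-* convergent sequences of
invariant measures. -/
def PropertyS {K : Type*} [TopologicalSpace K] [MeasurableSpace K]
    [OpensMeasurableSpace K] (h : K → K) : Prop :=
  ∀ (ν : ℕ → ProbabilityMeasure K) (μ : ProbabilityMeasure K),
    (∀ n, ν n ∈ invariantMeasures h) → Tendsto ν atTop (𝓝 μ) →
    limsup (fun n => metricEntropy h (ν n : Measure K)) atTop ≤ metricEntropy h (μ : Measure K)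

/-- Property `F_s`: some dense `G_δ` subset of the closure of the set of ergodic measures consists
of measures whose support is the whole space. -/
def PropertyFs {K : Type*} [TopologicalSpace K] [MeasurableSpace K]
    [OpensMeasurableSpace K] (h : K → K) : Prop :=
  ∃ R : Set (closure (ergodicMeasures h)), IsGδ R ∧ Dense R ∧
    ∀ μ ∈ R, ((μ : ProbabilityMeasure K) : Measure K).support = Set.univ

end ErgodicOptimization

end

set_option linter.unusedSectionVars false

namespace ErgodicOptimization

/-! ### Integration functionals, existence of maximizing measures, and their dependence on φ -/

section Basic

variable {K : Type*} [MetricSpace K] [CompactSpace K] [MeasurableSpace K] [BorelSpace K]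

/-! Write β(φ) for the maximal integral of φ. By weak-* compactness the relation "μ maximizes φ" is
closed and every φ has a maximizing measure. Replacing φ by φ + t g with small t > 0 keeps only
measures whose integral of g is nearly the largest among the maximizing measures of φ. Doing this
for a dense sequence of g, Baire's theorem gives generic uniqueness; a unique maximizing measure is
extreme, hence ergodic.

The other two claims follow from `exists_residual_unique_maximizing_mem`: the generic maximizing
measure lies in any countable family of open sets U whose ergodic members are dense among all
ergodic measures. To prove density for one U, start from φ with a unique, hence ergodic, maximizing
measure μ. An ergodic ν in U close to μ nearly maximizes φ. A Bishop–Phelps argument (Ekeland, then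
Hahn–Banach) moves φ slightly to some g with a maximizing measure norm-close to ν; since ν is
ergodic, it must itself maximize g (`exists_near_maximized_by_ergodic`). As ν is extreme, a
Milman-type argument yields ψ with strictly larger integral at ν than anywhere on the ergodic
closure minus U (`exists_separating_function`), so no measure of that set maximizes g + tψ.

For zero entropy, U excludes the invariant measures of entropy at least 1/n: `PropertyS` makes U
open, and `PropertyPePlus` gives density because periodic measures have zero entropy. For full
support, the U are the open sets defining the dense G_δ. -/

lemma integrable_continuousMap (φ : C(K, ℝ)) (μ : Measure K) [IsFiniteMeasure μ] :
    Integrable φ μ :=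
  φ.continuous.integrable_of_hasCompactSupport (HasCompactSupport.of_compactSpace φ)

lemma abs_integral_le_norm (φ : C(K, ℝ)) (μ : Measure K) [IsProbabilityMeasure μ] :
    |∫ x, φ x ∂μ| ≤ ‖φ‖ := by
  have := norm_integral_le_of_norm_le_const (μ := μ) (f := φ) (C := ‖φ‖)
    (Eventually.of_forall φ.norm_coe_le_norm)
  simpa using this

/-- Integration against a probability measure as an element of the weak-* dual of `C(K, ℝ)`. -/
noncomputable def integralDual (μ : ProbabilityMeasure K) : WeakDual ℝ C(K, ℝ) :=
  StrongDual.toWeakDual <| LinearMap.mkContinuous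
    { toFun := fun φ => ∫ x, φ x ∂(μ : Measure K)
      map_add' := fun φ ψ => by
        simpa using integral_add (integrable_continuousMap φ _) (integrable_continuousMap ψ _)
      map_smul' := fun c φ => by simpa using integral_const_mul c _ } 1
    (fun φ => by simpa using abs_integral_le_norm φ (μ : Measure K))

lemma integralDual_apply (μ : ProbabilityMeasure K) (φ : C(K, ℝ)) :
    integralDual μ φ = ∫ x, φ x ∂(μ : Measure K) := rfl

lemma abs_integralDual_le (μ : ProbabilityMeasure K) (φ : C(K, ℝ)) :
    |integralDual μ φ| ≤ ‖φ‖ := abs_integral_le_norm φ _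

lemma continuous_integralDual_apply (φ : C(K, ℝ)) :
    Continuous fun μ : ProbabilityMeasure K => integralDual μ φ :=
  ProbabilityMeasure.continuous_integral_continuousMap φ

lemma continuous_integralDual :
    Continuous (integralDual : ProbabilityMeasure K → WeakDual ℝ C(K, ℝ)) :=
  WeakDual.continuous_of_continuous_eval continuous_integralDual_apply

lemma measure_ext_of_forall_integral {μ ν : Measure K} [IsFiniteMeasure μ] [IsFiniteMeasure ν]
    (H : ∀ φ : C(K, ℝ), ∫ x, φ x ∂μ = ∫ x, φ x ∂ν) : μ = ν :=
  ext_of_forall_integral_eq_of_IsFiniteMeasure fun f => H f.toContinuousMap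

lemma integralDual_injective :
    Function.Injective (integralDual : ProbabilityMeasure K → WeakDual ℝ C(K, ℝ)) := by
  intro μ ν H
  exact ProbabilityMeasure.toMeasure_injective
    (measure_ext_of_forall_integral fun φ => congrArg (fun ℓ => ℓ φ) H)

/-- The bound |∫ (ψ - φ) dμ| ≤ ‖ψ - φ‖ is uniform in μ, which upgrades separate to joint continuity.
-/
lemma continuous_integralDual_uncurry :
    Continuous fun p : C(K, ℝ) × ProbabilityMeasure K => integralDual p.2 p.1 := by
  rw [continuous_iff_continuousAt]
  rintro ⟨φ, μ⟩
  have h1 : Tendsto (fun p : C(K, ℝ) × ProbabilityMeasure K => integralDual p.2 (p.1 - φ))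
      (𝓝 (φ, μ)) (𝓝 0) := by
    refine squeeze_zero_norm (fun p => abs_integralDual_le p.2 (p.1 - φ)) ?_
    have : Continuous fun p : C(K, ℝ) × ProbabilityMeasure K => ‖p.1 - φ‖ := by fun_prop
    simpa using this.tendsto (φ, μ)
  have h2 := ((continuous_integralDual_apply φ).comp continuous_snd).tendsto (φ, μ)
  have h3 := h1.add h2
  simp only [Function.comp_def, map_sub, sub_add_cancel, zero_add] at h3
  exact h3

lemma mem_invariantMeasures_iff {h : K → K} (hh : Continuous h) {μ : ProbabilityMeasure K} :
    μ ∈ invariantMeasures h ↔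
      ∀ φ : C(K, ℝ), integralDual μ (φ.comp ⟨h, hh⟩) = integralDual μ φ := by
  have hmap : ∀ φ : C(K, ℝ), ∫ x, φ x ∂((μ : Measure K).map h) =
      integralDual μ (φ.comp ⟨h, hh⟩) := fun φ =>
    integral_map hh.measurable.aemeasurable φ.continuous.aestronglyMeasurable
  have hf : IsProbabilityMeasure ((μ : Measure K).map h) :=
    Measure.isProbabilityMeasure_map hh.measurable.aemeasurable
  constructor
  · intro hμ φ
    have hμ' : (μ : Measure K).map h = μ := MeasurePreserving.map_eq hμ
    rw [← hmap, hμ', integralDual_apply]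
  · intro H
    refine ⟨hh.measurable, measure_ext_of_forall_integral fun φ => ?_⟩
    rw [hmap, H, integralDual_apply]

lemma isClosed_invariantMeasures {h : K → K} (hh : Continuous h) :
    IsClosed (invariantMeasures h) := by
  have : invariantMeasures h = ⋂ φ : C(K, ℝ),
      {μ | integralDual μ (φ.comp ⟨h, hh⟩) = integralDual μ φ} := by
    ext μ; simp [mem_invariantMeasures_iff hh]
  rw [this]
  exact isClosed_iInter fun φ =>
    isClosed_eq (continuous_integralDual_apply _) (continuous_integralDual_apply _)

lemma isProbabilityMeasure_orbitAverage (h : K → K) (x : K) {n : ℕ} (hn : n ≠ 0) :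
    IsProbabilityMeasure ((n : ℝ≥0∞)⁻¹ • ∑ i ∈ Finset.range n, Measure.dirac (h^[i] x)) := by
  constructor
  simp [ENNReal.inv_mul_cancel (Nat.cast_ne_zero.2 hn) (ENNReal.natCast_ne_top n)]

lemma integral_orbitAverage (h : K → K) (x : K) (n : ℕ) (φ : C(K, ℝ)) :
    ∫ y, φ y ∂((n : ℝ≥0∞)⁻¹ • ∑ i ∈ Finset.range n, Measure.dirac (h^[i] x)) =
      (n : ℝ)⁻¹ * ∑ i ∈ Finset.range n, φ (h^[i] x) := by
  rw [integral_smul_measure, integral_finsetSum_measure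
    (fun i _ => integrable_continuousMap φ _)]
  simp

/-- Krylov–Bogolyubov: a limit of orbit averages is invariant because the defect telescopes to two
boundary terms divided by the length. -/
lemma invariantMeasures_nonempty [Nonempty K] {h : K → K} (hh : Continuous h) :
    (invariantMeasures h).Nonempty := by
  obtain ⟨x⟩ := ‹Nonempty K›
  let μ : ℕ → ProbabilityMeasure K := fun n =>
    ⟨_, isProbabilityMeasure_orbitAverage h x n.succ_ne_zero⟩
  have hμ : ∀ n (φ : C(K, ℝ)), integralDual (μ n) φ =
      ((n + 1 : ℕ) : ℝ)⁻¹ * ∑ i ∈ Finset.range (n + 1), φ (h^[i] x) :=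
    fun n φ => integral_orbitAverage h x (n + 1) φ
  obtain ⟨ν, -, s, hs, hν⟩ := isCompact_univ.tendsto_subseq (fun n => Set.mem_univ (μ n))
  refine ⟨ν, (mem_invariantMeasures_iff hh).2 fun φ => ?_⟩
  have h1 : Tendsto (fun n => integralDual (μ (s n)) (φ.comp ⟨h, hh⟩) - integralDual (μ (s n)) φ)
      atTop (𝓝 (integralDual ν (φ.comp ⟨h, hh⟩) - integralDual ν φ)) :=
    (((continuous_integralDual_apply _).tendsto ν).comp hν).sub
      (((continuous_integralDual_apply _).tendsto ν).comp hν)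
  have h2 : Tendsto (fun n : ℕ => (2 * ‖φ‖) * ((n : ℝ) + 1)⁻¹) atTop (𝓝 0) := by
    simpa using (tendsto_one_div_add_atTop_nhds_zero_nat (𝕜 := ℝ)).const_mul (2 * ‖φ‖)
  have h3 : Tendsto (fun n => integralDual (μ (s n)) (φ.comp ⟨h, hh⟩) - integralDual (μ (s n)) φ)
      atTop (𝓝 0) := by
    refine squeeze_zero_norm (fun n => ?_) (h2.comp hs.tendsto_atTop)
    simp only [Function.comp_apply]
    have e : integralDual (μ (s n)) (φ.comp ⟨h, hh⟩) - integralDual (μ (s n)) φ =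
        ((s n : ℝ) + 1)⁻¹ * (φ (h^[s n + 1] x) - φ x) := by
      rw [hμ, hμ, ← mul_sub, ← Finset.sum_sub_distrib]
      have := Finset.sum_range_sub (fun i => φ (h^[i] x)) (s n + 1)
      simp only [Function.iterate_zero, id_eq] at this
      rw [← this]
      simp [Function.iterate_succ_apply']
    have hp : (0 : ℝ) < (s n : ℝ) + 1 := by positivity
    rw [e, norm_mul, norm_inv, Real.norm_of_nonneg hp.le, mul_comm]
    gcongr
    calc ‖φ (h^[s n + 1] x) - φ x‖ ≤ ‖φ (h^[s n + 1] x)‖ + ‖φ x‖ := norm_sub_le _ _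
      _ ≤ 2 * ‖φ‖ := by linarith [φ.norm_coe_le_norm (h^[s n + 1] x), φ.norm_coe_le_norm x]
  exact sub_eq_zero.1 (tendsto_nhds_unique h1 h3)

variable {h : K → K} {φ : C(K, ℝ)} {μ ν : ProbabilityMeasure K}

lemma integralDual_le_maxIntegral (hν : ν ∈ invariantMeasures h) :
    integralDual ν φ ≤ maxIntegral h φ := by
  refine le_ciSup (f := fun ν : invariantMeasures h => integralDual (ν : ProbabilityMeasure K) φ)
    ⟨‖φ‖, ?_⟩ ⟨ν, hν⟩
  rintro _ ⟨ν, rfl⟩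
  exact (le_abs_self _).trans (abs_integralDual_le _ _)

lemma integralDual_eq_maxIntegral (hμ : μ ∈ maximizingMeasures h φ) :
    integralDual μ φ = maxIntegral h φ := hμ.2.symm

lemma integralDual_le_of_mem_maximizingMeasures (hμ : μ ∈ maximizingMeasures h φ)
    (hν : ν ∈ invariantMeasures h) : integralDual ν φ ≤ integralDual μ φ :=
  (integralDual_le_maxIntegral hν).trans (integralDual_eq_maxIntegral hμ).ge

lemma mem_maximizingMeasures_iff : μ ∈ maximizingMeasures h φ ↔
    μ ∈ invariantMeasures h ∧
      ∀ ν ∈ invariantMeasures h, integralDual ν φ ≤ integralDual μ φ := by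
  refine ⟨fun hμ => ⟨hμ.1, fun ν => integralDual_le_of_mem_maximizingMeasures hμ⟩, fun hμ =>
    ⟨hμ.1, le_antisymm ?_ (integralDual_le_maxIntegral hμ.1)⟩⟩
  have : Nonempty (invariantMeasures h) := ⟨⟨μ, hμ.1⟩⟩
  exact ciSup_le fun ν => hμ.2 ν ν.2

lemma maximizingMeasures_nonempty [Nonempty K] (hh : Continuous h) (φ : C(K, ℝ)) :
    (maximizingMeasures h φ).Nonempty := by
  obtain ⟨μ, hμ, hmax⟩ := (isClosed_invariantMeasures hh).isCompact.exists_isMaxOn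
    (invariantMeasures_nonempty hh) (continuous_integralDual_apply φ).continuousOn
  exact ⟨μ, mem_maximizingMeasures_iff.2 ⟨hμ, fun ν hν => hmax hν⟩⟩

lemma isClosed_maximizingMeasures_graph (hh : Continuous h) :
    IsClosed {p : C(K, ℝ) × ProbabilityMeasure K | p.2 ∈ maximizingMeasures h p.1} := by
  have : {p : C(K, ℝ) × ProbabilityMeasure K | p.2 ∈ maximizingMeasures h p.1} =
      {p | p.2 ∈ invariantMeasures h} ∩
        ⋂ ν ∈ invariantMeasures h, {p | integralDual ν p.1 ≤ integralDual p.2 p.1} := by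
    ext p; simp [mem_maximizingMeasures_iff]
  rw [this]
  refine ((isClosed_invariantMeasures hh).preimage continuous_snd).inter
    (isClosed_biInter fun ν _ => isClosed_le ?_ continuous_integralDual_uncurry)
  exact (ContinuousLinearMap.continuous (WeakDual.toStrongDual (integralDual ν))).comp
    continuous_fst

lemma isClosed_maximizingMeasures (hh : Continuous h) (φ : C(K, ℝ)) :
    IsClosed (maximizingMeasures h φ) :=
  (isClosed_maximizingMeasures_graph hh).preimage
    (f := fun μ : ProbabilityMeasure K => (φ, μ)) (by fun_prop)

/-- Projection along the compact space of probability measures is a closed map. This upper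
semicontinuity underlies all the openness claims below. -/
lemma isClosed_setOf_exists_maximizing_mem (hh : Continuous h) {F : Set (ProbabilityMeasure K)}
    (hF : IsClosed F) : IsClosed {φ : C(K, ℝ) | ∃ μ ∈ maximizingMeasures h φ, μ ∈ F} := by
  have := isClosedMap_fst_of_compactSpace (X := C(K, ℝ)) _
    ((isClosed_maximizingMeasures_graph hh).inter (hF.preimage continuous_snd))
  convert this using 1
  ext φ
  simp

lemma maxIntegral_le_add_dist [Nonempty K] (hh : Continuous h) (φ ψ : C(K, ℝ)) :
    maxIntegral h φ ≤ maxIntegral h ψ + dist φ ψ := by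
  obtain ⟨μ, hμ⟩ := maximizingMeasures_nonempty hh φ
  have h1 := abs_integralDual_le μ (φ - ψ)
  rw [map_sub, ← dist_eq_norm] at h1
  have h2 := integralDual_le_maxIntegral (φ := ψ) hμ.1
  rw [← integralDual_eq_maxIntegral hμ]
  linarith [le_abs_self (integralDual μ φ - integralDual μ ψ)]

lemma continuous_maxIntegral [Nonempty K] (hh : Continuous h) :
    Continuous (maxIntegral h : C(K, ℝ) → ℝ) :=
  (LipschitzWith.of_le_add (maxIntegral_le_add_dist hh)).continuous

end Basic

end ErgodicOptimization

namespace ErgodicOptimization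

/-! ### Generic uniqueness, and ergodicity of a unique maximizing measure -/

section Uniqueness

variable {K : Type*} [MetricSpace K] [CompactSpace K] [MeasurableSpace K] [BorelSpace K]
  {h : K → K}

lemma continuous_add_smul (φ ψ : C(K, ℝ)) : Continuous fun t : ℝ => φ + t • ψ := by fun_prop

/-- Along a small perturbation `φ + t • g` the integral of `g` against maximizing measures is
pinned to a small interval. -/
lemma exists_perturbation_integral_mem_Ico [Nonempty K] (hh : Continuous h) (φ g : C(K, ℝ))
    {U : Set C(K, ℝ)} (hU : U ∈ 𝓝 φ) {δ : ℝ} (hδ : 0 < δ) :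
    ∃ φ' ∈ U, ∃ m : ℝ, ∀ μ ∈ maximizingMeasures h φ',
      integralDual μ g ∈ Set.Ico m (m + δ) := by
  obtain ⟨μ₀, hμ₀, hmax⟩ := (isClosed_maximizingMeasures hh φ).isCompact.exists_isMaxOn
    (maximizingMeasures_nonempty hh φ) (continuous_integralDual_apply g).continuousOn
  set m := integralDual μ₀ g
  -- The upper bound persists near φ by semicontinuity; the lower bound comes from comparing with μ₀
  -- in the direction g.
  have hV : {ψ : C(K, ℝ) | ∃ μ ∈ maximizingMeasures h ψ, μ ∈ {μ | m + δ ≤ integralDual μ g}}ᶜ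
      ∈ 𝓝 φ := by
    refine (isClosed_setOf_exists_maximizing_mem hh
      (isClosed_le continuous_const (continuous_integralDual_apply g))).isOpen_compl.mem_nhds ?_
    rintro ⟨μ, hμ, hle⟩
    have h1 : integralDual μ g ≤ m := hmax hμ
    have h2 : m + δ ≤ integralDual μ g := hle
    linarith
  have ht : Tendsto (fun t : ℝ => φ + t • g) (𝓝[>] 0) (𝓝 φ) := by
    have := (continuous_add_smul φ g).tendsto 0
    simp only [zero_smul, add_zero] at this
    exact this.mono_left nhdsWithin_le_nhds
  obtain ⟨t, htUV, ht0⟩ := ((ht.eventually (inter_mem hU hV)).and self_mem_nhdsWithin).exists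
  refine ⟨φ + t • g, htUV.1, m, fun μ hμ => ⟨?_, ?_⟩⟩
  · have h1 := integralDual_le_of_mem_maximizingMeasures hμ hμ₀.1
    have h2 := integralDual_le_of_mem_maximizingMeasures hμ₀ hμ.1
    simp only [map_add, map_smul, smul_eq_mul] at h1
    exact le_of_mul_le_mul_left (by linarith) (show (0 : ℝ) < t from ht0)
  · by_contra hlt
    exact htUV.2 ⟨μ, hμ, not_lt.1 hlt⟩

/-- The functions having maximizing measures whose integrals of `g` are at most `p` and
at least `q`. -/
def nonUniqueAt (h : K → K) (g : C(K, ℝ)) (p q : ℝ) : Set C(K, ℝ) :=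
  {φ | ∃ μ ∈ maximizingMeasures h φ, μ ∈ {μ | integralDual μ g ≤ p}} ∩
    {φ | ∃ μ ∈ maximizingMeasures h φ, μ ∈ {μ | q ≤ integralDual μ g}}

lemma isClosed_nonUniqueAt (hh : Continuous h) (g : C(K, ℝ)) (p q : ℝ) :
    IsClosed (nonUniqueAt h g p q) :=
  (isClosed_setOf_exists_maximizing_mem hh
    (isClosed_le (continuous_integralDual_apply g) continuous_const)).inter
  (isClosed_setOf_exists_maximizing_mem hh
    (isClosed_le continuous_const (continuous_integralDual_apply g)))

lemma dense_compl_nonUniqueAt [Nonempty K] (hh : Continuous h) (g : C(K, ℝ)) {p q : ℝ}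
    (hpq : p < q) : Dense (nonUniqueAt h g p q)ᶜ := by
  intro φ
  rw [mem_closure_iff_nhds]
  intro U hU
  obtain ⟨φ', hφ', m, hm⟩ := exists_perturbation_integral_mem_Ico hh φ g hU (sub_pos.2 hpq)
  refine ⟨φ', hφ', ?_⟩
  rintro ⟨⟨μ, hμ, h1⟩, μ', hμ', h2⟩
  have h1' : integralDual μ g ≤ p := h1
  have h2' : q ≤ integralDual μ' g := h2
  have := (hm μ hμ).1
  have := (hm μ' hμ').2
  linarith

/-- For generic `φ` the maximizing measure is unique. -/
theorem exists_residual_unique_maximizing [Nonempty K] (hh : Continuous h) :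
    ∃ R : Set C(K, ℝ), IsGδ R ∧ Dense R ∧
      ∀ φ ∈ R, ∃ μ : ProbabilityMeasure K, maximizingMeasures h φ = {μ} := by
  let S : Set (ℕ × ℚ × ℚ) := {i | i.2.1 < i.2.2}
  let G : S → Set C(K, ℝ) := fun i =>
    (nonUniqueAt h (TopologicalSpace.denseSeq C(K, ℝ) i.1.1) i.1.2.1 i.1.2.2)ᶜ
  have hG : ∀ i, IsOpen (G i) := fun i => (isClosed_nonUniqueAt hh _ _ _).isOpen_compl
  refine ⟨⋂ i, G i, IsGδ.iInter_of_isOpen hG, dense_iInter_of_isOpen hG fun i =>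
    dense_compl_nonUniqueAt hh _ (Rat.cast_lt.2 i.2), fun φ hφ => ?_⟩
  obtain ⟨μ, hμ⟩ := maximizingMeasures_nonempty hh φ
  have key : ∀ ν₁ ∈ maximizingMeasures h φ, ∀ ν₂ ∈ maximizingMeasures h φ, ∀ n,
      integralDual ν₂ (TopologicalSpace.denseSeq C(K, ℝ) n) ≤
        integralDual ν₁ (TopologicalSpace.denseSeq C(K, ℝ) n) := by
    intro ν₁ h₁ ν₂ h₂ n
    by_contra! hlt
    -- Two rationals are needed, since the closed sets `nonUniqueAt` are nowhere dense only across a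
    -- genuine gap p < q.
    obtain ⟨p, hp, hp'⟩ := exists_rat_btwn hlt
    obtain ⟨q, hq, hq'⟩ := exists_rat_btwn hp'
    exact Set.mem_iInter.1 hφ ⟨(n, p, q), Rat.cast_lt.1 hq⟩
      ⟨⟨ν₁, h₁, hp.le⟩, ν₂, h₂, hq'.le⟩
  refine ⟨μ, Set.eq_singleton_iff_unique_mem.2 ⟨hμ, fun ν hν => integralDual_injective ?_⟩⟩
  refine DFunLike.coe_injective (Continuous.ext_on (TopologicalSpace.denseRange_denseSeq C(K, ℝ))
    (WeakDual.toStrongDual (integralDual ν)).continuous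
    (WeakDual.toStrongDual (integralDual μ)).continuous ?_)
  rintro _ ⟨n, rfl⟩
  exact le_antisymm (key μ hμ ν hν n) (key ν hν μ hμ n)

/-- Convex combination of probability measures. -/
noncomputable def convexComb (a b : ℝ) (ha : 0 ≤ a) (hb : 0 ≤ b) (hab : a + b = 1)
    (μ ν : ProbabilityMeasure K) : ProbabilityMeasure K :=
  ⟨ENNReal.ofReal a • (μ : Measure K) + ENNReal.ofReal b • (ν : Measure K),
    ⟨by simp [← ENNReal.ofReal_add ha hb, hab]⟩⟩

lemma integralDual_convexComb {a b : ℝ} (ha : 0 ≤ a) (hb : 0 ≤ b) (hab : a + b = 1)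
    (μ ν : ProbabilityMeasure K) :
    integralDual (convexComb a b ha hb hab μ ν) = a • integralDual μ + b • integralDual ν := by
  refine DFunLike.ext _ _ fun φ => ?_
  change ∫ x, φ x ∂(ENNReal.ofReal a • (μ : Measure K) + ENNReal.ofReal b • (ν : Measure K)) =
    a * ∫ x, φ x ∂(μ : Measure K) + b * ∫ x, φ x ∂(ν : Measure K)
  rw [integral_add_measure ((integrable_continuousMap φ _).smul_measure ENNReal.ofReal_ne_top)
    ((integrable_continuousMap φ _).smul_measure ENNReal.ofReal_ne_top), integral_smul_measure,
    integral_smul_measure, ENNReal.toReal_ofReal ha, ENNReal.toReal_ofReal hb]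
  rfl

lemma convexComb_mem_invariantMeasures (hh : Continuous h) {a b : ℝ} (ha : 0 ≤ a) (hb : 0 ≤ b)
    (hab : a + b = 1) {μ ν : ProbabilityMeasure K} (hμ : μ ∈ invariantMeasures h)
    (hν : ν ∈ invariantMeasures h) : convexComb a b ha hb hab μ ν ∈ invariantMeasures h := by
  rw [mem_invariantMeasures_iff hh] at *
  intro φ
  rw [integralDual_convexComb]
  change a * integralDual μ (φ.comp ⟨h, hh⟩) + b * integralDual ν (φ.comp ⟨h, hh⟩) =
    a * integralDual μ φ + b * integralDual ν φ
  rw [hμ, hν]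

lemma convex_image_maximizingMeasures (hh : Continuous h) (φ : C(K, ℝ)) :
    Convex ℝ (integralDual '' maximizingMeasures h φ) := by
  rintro _ ⟨μ, hμ, rfl⟩ _ ⟨ν, hν, rfl⟩ a b ha hb hab
  refine ⟨convexComb a b ha hb hab μ ν, mem_maximizingMeasures_iff.2
    ⟨convexComb_mem_invariantMeasures hh ha hb hab hμ.1 hν.1, fun ρ hρ => ?_⟩,
    integralDual_convexComb ha hb hab μ ν⟩
  rw [integralDual_convexComb]
  change integralDual ρ φ ≤ a * integralDual μ φ + b * integralDual ν φ
  rw [integralDual_eq_maxIntegral hμ, integralDual_eq_maxIntegral hν, ← add_mul, hab, one_mul]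
  exact integralDual_le_maxIntegral hρ

/-- An ergodic measure is not a proper convex combination of invariant measures. -/
lemma eq_of_convexComb_eq_ergodic {a b : ℝ} (ha : 0 < a) (hb : 0 ≤ b) (hab : a + b = 1)
    {μ₁ μ₂ ν : ProbabilityMeasure K} (hν : ν ∈ ergodicMeasures h) (hμ₁ : μ₁ ∈ invariantMeasures h)
    (H : a • integralDual μ₁ + b • integralDual μ₂ = integralDual ν) : μ₁ = ν := by
  rw [← integralDual_convexComb ha.le hb hab] at H
  refine ProbabilityMeasure.toMeasure_injective (Ergodic.eq_of_absolutelyContinuous hν hμ₁ ?_)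
  rw [← integralDual_injective H]
  exact .add_right (Measure.absolutelyContinuous_smul (by simpa using ha)) _

/-- If the maximizing measure is unique then it is ergodic. -/
lemma ergodic_of_maximizingMeasures_eq_singleton {φ : C(K, ℝ)} {μ : ProbabilityMeasure K}
    (hμ : maximizingMeasures h φ = {μ}) : μ ∈ ergodicMeasures h := by
  have hμm : μ ∈ maximizingMeasures h φ := hμ ▸ Set.mem_singleton μ
  refine Ergodic.of_mem_extremePoints ?_
  rw [mem_extremePoints_iff_left]
  refine ⟨⟨hμm.1, inferInstance⟩, ?_⟩
  rintro ν₁ ⟨hi₁, hp₁⟩ ν₂ ⟨hi₂, hp₂⟩ ⟨a, b, ha, hb, hab, he⟩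
  have ha' : a ≠ ∞ := fun H => by simp [H] at hab
  have hb' : b ≠ ∞ := fun H => by simp [H] at hab
  have e : integralDual μ φ = a.toReal * integralDual ⟨ν₁, hp₁⟩ φ +
      b.toReal * integralDual ⟨ν₂, hp₂⟩ φ := by
    rw [integralDual_apply, ← he,
      integral_add_measure ((integrable_continuousMap φ _).smul_measure ha')
      ((integrable_continuousMap φ _).smul_measure hb'), integral_smul_measure,
      integral_smul_measure]
    rfl
  have hab' : a.toReal + b.toReal = 1 := by
    rw [← ENNReal.toReal_add ha' hb', hab, ENNReal.toReal_one]
  have h₁ : integralDual ⟨ν₁, hp₁⟩ φ ≤ maxIntegral h φ := integralDual_le_maxIntegral hi₁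
  have h₂ : integralDual ⟨ν₂, hp₂⟩ φ ≤ maxIntegral h φ := integralDual_le_maxIntegral hi₂
  rw [integralDual_eq_maxIntegral hμm] at e
  -- An average with positive weights of two numbers at most β(φ) equals β(φ) only if both do.
  have h₃ : maxIntegral h φ = integralDual ⟨ν₁, hp₁⟩ φ := by
    have hap := ENNReal.toReal_pos ha.ne' ha'
    have hbp := ENNReal.toReal_pos hb.ne' hb'
    refine le_antisymm (le_of_mul_le_mul_left ?_ hap) h₁
    have : b.toReal * integralDual ⟨ν₂, hp₂⟩ φ ≤ b.toReal * maxIntegral h φ := by gcongr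
    have e' : maxIntegral h φ = a.toReal * maxIntegral h φ + b.toReal * maxIntegral h φ := by
      rw [← add_mul, hab', one_mul]
    linarith
  have h₄ : (⟨ν₁, hp₁⟩ : ProbabilityMeasure K) ∈ maximizingMeasures h φ := ⟨hi₁, h₃⟩
  rw [hμ] at h₄
  exact congrArg ProbabilityMeasure.toMeasure h₄

end Uniqueness

end ErgodicOptimization

/-! ### Ekeland's variational principle -/

/-- **Ekeland's variational principle** for a nonnegative continuous function. -/
lemma exists_ekeland {X : Type*} [MetricSpace X] [CompleteSpace X] {f : X → ℝ} (hf : Continuous f)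
    (h0 : ∀ x, 0 ≤ f x) {η : ℝ} (hη : 0 < η) (x₀ : X) :
    ∃ x, f x + η * dist x₀ x ≤ f x₀ ∧ ∀ y, f x ≤ f y + η * dist x y := by
  -- S x collects the points below x in Ekeland's partial order. The sequence u descends in it, its
  -- nth step minimizing f on the current set up to 1/(n+1).
  let S : X → Set X := fun x => {y | f y + η * dist x y ≤ f x}
  have hself : ∀ x, x ∈ S x := fun x => by simp [S]
  have hclosed : ∀ x, IsClosed (S x) := fun x => isClosed_le (by fun_prop) continuous_const
  have htrans : ∀ x y z, y ∈ S x → z ∈ S y → z ∈ S x := by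
    intro x y z hxy hyz
    simp only [S, Set.mem_ofPred_eq] at *
    nlinarith [dist_triangle x y z]
  have hnext : ∀ (n : ℕ) (x : X), ∃ y ∈ S x, ∀ z ∈ S x, f y ≤ f z + 1 / ((n : ℝ) + 1) := by
    intro n x
    have hne : (f '' S x).Nonempty := ⟨_, x, hself x, rfl⟩
    have hbdd : BddBelow (f '' S x) := ⟨0, by rintro _ ⟨y, -, rfl⟩; exact h0 y⟩
    obtain ⟨_, ⟨y, hy, rfl⟩, hlt⟩ := Real.lt_sInf_add_pos hne
      (show (0 : ℝ) < 1 / ((n : ℝ) + 1) by positivity)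
    exact ⟨y, hy, fun z hz => hlt.le.trans
      (add_le_add_left (csInf_le hbdd ⟨z, hz, rfl⟩) _)⟩
  choose next hnext_mem hnext_le using hnext
  let u : ℕ → X := fun n => Nat.rec x₀ (fun n x => next n x) n
  have hu : ∀ n, u (n + 1) = next n (u n) := fun _ => rfl
  have hmem : ∀ n m, n ≤ m → u m ∈ S (u n) := by
    intro n m hnm
    induction m, hnm using Nat.le_induction with
    | base => exact hself _
    | succ m _ ih => exact htrans _ _ _ ih (hu m ▸ hnext_mem m (u m))
  have hanti : Antitone (f ∘ u) := fun n m hnm => by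
    have : f (u m) + η * dist (u n) (u m) ≤ f (u n) := hmem n m hnm
    have : 0 ≤ η * dist (u n) (u m) := by positivity
    simp only [Function.comp_apply]
    linarith
  have hbdd : BddBelow (Set.range (f ∘ u)) := ⟨0, by rintro _ ⟨n, rfl⟩; exact h0 _⟩
  have hlim := tendsto_atTop_ciInf hanti hbdd
  set L := ⨅ n, (f ∘ u) n
  have hdist : ∀ N n, N ≤ n → dist (u N) (u n) ≤ η⁻¹ * ((f ∘ u) N - L) := by
    intro N n hn
    have h1 : f (u n) + η * dist (u N) (u n) ≤ f (u N) := hmem N n hn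
    have h2 : L ≤ f (u n) := ciInf_le hbdd n
    rw [inv_mul_eq_div, le_div_iff₀ hη]
    simp only [Function.comp_apply]
    linarith
  have hcauchy : CauchySeq u := by
    refine cauchySeq_of_le_tendsto_0 (fun N => 2 * (η⁻¹ * ((f ∘ u) N - L))) ?_ ?_
    · intro n m N hn hm
      have := dist_triangle_left (u n) (u m) (u N)
      linarith [hdist N n hn, hdist N m hm]
    · simpa using ((hlim.sub_const L).const_mul η⁻¹).const_mul 2
  obtain ⟨x, hx⟩ := cauchySeq_tendsto_of_complete hcauchy
  have hxmem : ∀ n, x ∈ S (u n) := fun n =>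
    (hclosed (u n)).mem_of_tendsto hx ((eventually_ge_atTop n).mono fun m hm => hmem n m hm)
  refine ⟨x, hxmem 0, fun y => ?_⟩
  -- A violating y would lie below x, hence below every u n; near-minimality then gives f x ≤ f y, a
  -- contradiction.
  by_contra! hlt
  have hy : y ∈ S x := hlt.le
  have hxy : f x ≤ f y := by
    have h1 : Tendsto (fun n : ℕ => f y + 1 / ((n : ℝ) + 1)) atTop (𝓝 (f y)) := by
      simpa using tendsto_one_div_add_atTop_nhds_zero_nat.const_add (f y)
    refine le_of_tendsto_of_tendsto
      ((hf.tendsto x).comp (hx.comp (tendsto_add_atTop_nat 1))) h1 (Eventually.of_forall fun n => ?_)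
    simpa [hu] using hnext_le n (u n) y (htrans _ _ _ (hxmem n) hy)
  have : 0 ≤ η * dist x y := by positivity
  linarith

namespace ErgodicOptimization

/-! ### Bishop–Phelps argument: near-maximizing ergodic measures -/

section BishopPhelps

variable {K : Type*} [MetricSpace K] [CompactSpace K] [MeasurableSpace K] [BorelSpace K]
  {h : K → K}

instance instLocallyConvexSpaceWeakDual : LocallyConvexSpace ℝ (WeakDual ℝ C(K, ℝ)) :=
  inferInstanceAs (LocallyConvexSpace ℝ (WeakBilin (topDualPairing ℝ C(K, ℝ))))

lemma exists_eq_eval (f : StrongDual ℝ (WeakDual ℝ C(K, ℝ))) :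
    ∃ ψ : C(K, ℝ), ∀ ℓ : WeakDual ℝ C(K, ℝ), f ℓ = ℓ ψ := by
  obtain ⟨ψ, hψ⟩ := LinearMap.dualEmbedding_surjective (topDualPairing ℝ C(K, ℝ)) f
  exact ⟨ψ, fun ℓ => by rw [← hψ]; rfl⟩

/-- If `β(φ) + ‖φ - g‖ / 2 - ∫ φ dν` is minimal at `φ = g`, some maximizing measure of `g` is
within distance `1 / 2` of `ν`, as functionals. -/
lemma exists_maximizing_near [Nonempty K] (hh : Continuous h) (ν : ProbabilityMeasure K)
    (g : C(K, ℝ)) (H : ∀ φ, maxIntegral h g - integralDual ν g ≤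
      maxIntegral h φ - integralDual ν φ + 1 / 2 * dist g φ) :
    ∃ μ ∈ maximizingMeasures h g, ∀ ψ, |integralDual μ ψ - integralDual ν ψ| ≤ 1 / 2 * ‖ψ‖ := by
  -- The norm ball of radius 1/2 about ν, written as an intersection of weak-* closed conditions.
  let t : Set (WeakDual ℝ C(K, ℝ)) :=
    ⋂ ψ : C(K, ℝ), {ℓ | |ℓ ψ - integralDual ν ψ| ≤ 1 / 2 * ‖ψ‖}
  have ht_closed : IsClosed t := isClosed_iInter fun ψ =>
    isClosed_le ((WeakDual.eval_continuous ψ).sub continuous_const).abs continuous_const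
  have ht_convex : Convex ℝ t := by
    refine convex_iInter fun ψ => ?_
    intro ℓ₁ h₁ ℓ₂ h₂ a b ha hb hab
    simp only [Set.mem_ofPred_eq] at h₁ h₂ ⊢
    change |a * ℓ₁ ψ + b * ℓ₂ ψ - integralDual ν ψ| ≤ _
    rw [abs_le] at *
    obtain rfl : b = 1 - a := by linarith
    have h₃ := mul_le_mul_of_nonneg_left h₁.1 ha
    have h₄ := mul_le_mul_of_nonneg_left h₁.2 ha
    have h₅ := mul_le_mul_of_nonneg_left h₂.1 hb
    have h₆ := mul_le_mul_of_nonneg_left h₂.2 hb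
    constructor <;> linarith
  by_contra! Hno
  have hdisj : Disjoint (integralDual '' maximizingMeasures h g) t := by
    rw [Set.disjoint_left]
    rintro _ ⟨μ, hμ, rfl⟩ hmem
    obtain ⟨ψ, hψ⟩ := Hno μ hμ
    exact hψ.not_ge (Set.mem_iInter.1 hmem ψ)
  obtain ⟨f, u, v, hu, huv, hv⟩ := geometric_hahn_banach_compact_closed
    (convex_image_maximizingMeasures hh g)
    ((isClosed_maximizingMeasures hh g).isCompact.image continuous_integralDual)
    ht_convex ht_closed hdisj
  obtain ⟨ψ, hψ⟩ := exists_eq_eval f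
  simp only [hψ] at hu hv
  -- A norming functional for ψ gives a point of the ball where evaluation at ψ is as small as
  -- possible.
  have hbound : v < integralDual ν ψ - 1 / 2 * ‖ψ‖ := by
    obtain ⟨ℓ, hℓ, hℓψ⟩ := exists_dual_vector'' ℝ ψ
    have := hv (integralDual ν - (1 / 2 : ℝ) • StrongDual.toWeakDual ℓ) ?_
    · change v < integralDual ν ψ - 1 / 2 * ℓ ψ at this
      rwa [hℓψ] at this
    · refine Set.mem_iInter.2 fun χ => ?_
      change |integralDual ν χ - 1 / 2 * ℓ χ - integralDual ν χ| ≤ _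
      have h1 : |ℓ χ| ≤ ‖χ‖ := ℓ.le_of_opNorm_le hℓ χ |>.trans_eq (one_mul _)
      rw [sub_sub_cancel_left, abs_neg, abs_mul, abs_of_pos (by norm_num : (0 : ℝ) < 1 / 2)]
      gcongr
  have hclosed := isClosed_setOf_exists_maximizing_mem hh
    (F := {μ | integralDual ν ψ - 1 / 2 * ‖ψ‖ ≤ integralDual μ ψ})
    (isClosed_le continuous_const (continuous_integralDual_apply ψ))
  have htend : Tendsto (fun t : ℝ => g + t • ψ) (𝓝[>] 0) (𝓝 g) := by
    have := (continuous_add_smul g ψ).tendsto 0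
    simp only [zero_smul, add_zero] at this
    exact this.mono_left nhdsWithin_le_nhds
  -- Minimality tested at g + tψ bounds ∫ ψ from below at maximizing measures of g + tψ. Letting t →
  -- 0 yields a maximizing measure of g on the wrong side of the separation.
  obtain ⟨μ, hμ, hμψ⟩ := hclosed.mem_of_tendsto htend <| by
    filter_upwards [self_mem_nhdsWithin] with t ht
    have ht' : (0 : ℝ) < t := ht
    obtain ⟨μ, hμ⟩ := maximizingMeasures_nonempty hh (g + t • ψ)
    refine ⟨μ, hμ, ?_⟩
    have h1 := H (g + t • ψ)
    have h2 := integralDual_le_maxIntegral (φ := g) hμ.1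
    rw [← integralDual_eq_maxIntegral hμ, dist_self_add_right, norm_smul,
      Real.norm_of_nonneg ht'.le] at h1
    simp only [map_add, map_smul, smul_eq_mul] at h1
    exact le_of_mul_le_mul_left (by linarith) ht'
  have h1 := hu _ ⟨μ, hμ, rfl⟩
  have h2 : integralDual ν ψ - 1 / 2 * ‖ψ‖ ≤ integralDual μ ψ := hμψ
  linarith

/-- Mutually singular probability measures have distance `2` as functionals on `C(K, ℝ)`. -/
lemma not_mutuallySingular_of_abs_sub_le {μ ν : ProbabilityMeasure K}
    (H : ∀ ψ, |integralDual μ ψ - integralDual ν ψ| ≤ 1 / 2 * ‖ψ‖) :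
    ¬ (μ : Measure K).MutuallySingular (ν : Measure K) := by
  rintro ⟨s, hs, hμs, hνs⟩
  have hνs1 : (ν : Measure K) s = 1 := (prob_compl_eq_zero_iff hs).1 hνs
  -- The thresholds 7/8 and 1/8 only need to differ by more than 1/2, the assumed bound on the
  -- distance.
  obtain ⟨F, hFs, hF, hνF⟩ := MeasurableSet.exists_lt_isClosed_of_ne_top
    (μ := (ν : Measure K)) hs (measure_ne_top _ _) (r := ENNReal.ofReal (7 / 8)) (by
      rw [hνs1]; exact ENNReal.ofReal_lt_one.2 (by norm_num))
  obtain ⟨U, hFU, hU, hμU⟩ := F.exists_isOpen_lt_of_lt (μ := (μ : Measure K))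
    (ENNReal.ofReal (1 / 8)) (by
      rw [measure_mono_null hFs hμs]; exact ENNReal.ofReal_pos.2 (by norm_num))
  obtain ⟨ψ, hψ0, hψ1, hψ⟩ := exists_continuous_zero_one_of_isClosed hU.isClosed_compl hF
    (Set.disjoint_left.2 fun x hx hxF => hx (hFU hxF))
  have hnorm : ‖ψ‖ ≤ 1 := (ContinuousMap.norm_le _ zero_le_one).2 fun x => by
    rw [Real.norm_of_nonneg (hψ x).1]; exact (hψ x).2
  have h1 : 7 / 8 ≤ integralDual ν ψ := by
    have e : ∫ x, F.indicator (1 : K → ℝ) x ∂(ν : Measure K) ≤ integralDual ν ψ := by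
      refine integral_mono ((integrable_indicator_iff hF.measurableSet).2 (integrable_const _).integrableOn)
        (integrable_continuousMap ψ _) fun x => ?_
      by_cases hx : x ∈ F
      · simp [hx, hψ1 hx]
      · simpa [hx] using (hψ x).1
    rw [integral_indicator_one hF.measurableSet] at e
    exact ((ENNReal.ofReal_le_iff_le_toReal (measure_ne_top _ _)).1 hνF.le).trans e
  have h2 : integralDual μ ψ ≤ 1 / 8 := by
    have e : integralDual μ ψ ≤ ∫ x, U.indicator (1 : K → ℝ) x ∂(μ : Measure K) := by
      refine integral_mono (integrable_continuousMap ψ _)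
        ((integrable_indicator_iff hU.measurableSet).2 (integrable_const _).integrableOn) fun x => ?_
      by_cases hx : x ∈ U
      · simpa [hx] using (hψ x).2
      · simp [hx, hψ0 (show x ∈ Uᶜ from hx)]
    rw [integral_indicator_one hU.measurableSet] at e
    exact e.trans (ENNReal.toReal_le_of_le_ofReal (by norm_num) hμU.le)
  have h3 := H ψ
  rw [abs_le] at h3
  linarith [h3.1]

lemma integral_le_of_invariant {σ : Measure K} [IsFiniteMeasure σ] (hσ : MeasurePreserving h σ σ)
    (φ : C(K, ℝ)) : ∫ x, φ x ∂σ ≤ σ.real Set.univ * maxIntegral h φ := by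
  rcases eq_or_ne σ 0 with rfl | h0
  · simp
  have hu : σ Set.univ ≠ 0 := by simpa using h0
  have hpos : 0 < σ.real Set.univ := ENNReal.toReal_pos hu (measure_ne_top _ _)
  have hp : IsProbabilityMeasure ((σ Set.univ)⁻¹ • σ) :=
    ⟨by simp [ENNReal.inv_mul_cancel hu (measure_ne_top _ _)]⟩
  have := integralDual_le_maxIntegral (h := h) (φ := φ) (ν := ⟨_, hp⟩) (hσ.smul_measure _)
  change ∫ x, φ x ∂((σ Set.univ)⁻¹ • σ) ≤ _ at this
  rw [integral_smul_measure, ENNReal.toReal_inv, smul_eq_mul, ← measureReal_def, inv_mul_le_iff₀ hpos] at this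
  exact this

/-- An ergodic measure not singular to some maximizing measure of `g` maximizes `g`. -/
lemma ergodic_mem_maximizingMeasures {μ ν : ProbabilityMeasure K} {g : C(K, ℝ)}
    (hμ : μ ∈ maximizingMeasures h g) (hν : ν ∈ ergodicMeasures h)
    (hs : ¬ (μ : Measure K).MutuallySingular (ν : Measure K)) : ν ∈ maximizingMeasures h g := by
  have hμi : MeasurePreserving h (μ : Measure K) μ := hμ.1
  have hνe : Ergodic h (ν : Measure K) := hν
  -- The part of μ absolutely continuous with respect to ν is invariant, so ergodicity makes it cν.
  -- Both cν and the singular part integrate g to at most mass times β(g), and their sum attains the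
  -- bound.
  obtain ⟨c, hc⟩ := hνe.eq_smul_of_absolutelyContinuous
    (hμi.withDensity_rnDeriv hνe.toMeasurePreserving) (withDensity_absolutelyContinuous _ _)
  have hdec := (μ : Measure K).singularPart_add_rnDeriv (ν : Measure K)
  rw [hc] at hdec
  set σ := (μ : Measure K).singularPart (ν : Measure K) with hσ
  have hσi : MeasurePreserving h σ σ := hμi.singularPart hνe.toMeasurePreserving
  have hmass : σ Set.univ + c = 1 := by
    have := congrArg (fun m : Measure K => m Set.univ) hdec
    simpa using this
  have hc0 : c ≠ 0 := by
    rintro rfl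
    rw [zero_smul, add_zero] at hdec
    exact hs (hdec ▸ Measure.mutuallySingular_singularPart _ _)
  have hct : c ≠ ∞ := fun H => by simp [H] at hmass
  have hmass' : σ.real Set.univ + c.toReal = 1 := by
    rw [measureReal_def, ← ENNReal.toReal_add (measure_ne_top _ _) hct, hmass, ENNReal.toReal_one]
  have e : integralDual μ g = ∫ x, g x ∂σ + c.toReal * integralDual ν g := by
    rw [integralDual_apply, ← hdec, integral_add_measure (integrable_continuousMap g _)
      ((integrable_continuousMap g _).smul_measure hct), integral_smul_measure]
    rfl
  have h1 := integral_le_of_invariant hσi g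
  rw [integralDual_eq_maxIntegral hμ] at e
  refine ⟨hνe.toMeasurePreserving, le_antisymm ?_
    (integralDual_le_maxIntegral hνe.toMeasurePreserving)⟩
  refine le_of_mul_le_mul_left (a := c.toReal) ?_ (ENNReal.toReal_pos hc0 hct)
  have e' : maxIntegral h g = σ.real Set.univ * maxIntegral h g + c.toReal * maxIntegral h g := by
    rw [← add_mul, hmass', one_mul]
  rw [← integralDual_apply]
  linarith

/-- An ergodic measure that nearly maximizes `φ` maximizes some function near `φ`. -/
theorem exists_near_maximized_by_ergodic [Nonempty K] (hh : Continuous h)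
    {ν : ProbabilityMeasure K} (hν : ν ∈ ergodicMeasures h) (φ : C(K, ℝ)) :
    ∃ g : C(K, ℝ), dist φ g ≤ 2 * (maxIntegral h φ - integralDual ν φ) ∧
      ν ∈ maximizingMeasures h g := by
  have hνi : ν ∈ invariantMeasures h := Ergodic.toMeasurePreserving hν
  -- The slope 1/2 yields the factor 2 in the distance estimate and keeps the two measures closer
  -- than mutually singular ones can be.
  obtain ⟨g, hg, hmin⟩ := exists_ekeland (f := fun φ => maxIntegral h φ - integralDual ν φ)
    ((continuous_maxIntegral hh).sub (WeakDual.toStrongDual (integralDual ν)).continuous)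
    (fun φ => sub_nonneg.2 (integralDual_le_maxIntegral hνi)) (η := 1 / 2) (by norm_num) φ
  obtain ⟨μ, hμ, hμν⟩ := exists_maximizing_near hh ν g hmin
  refine ⟨g, ?_, ergodic_mem_maximizingMeasures hμ hν (not_mutuallySingular_of_abs_sub_le hμν)⟩
  have : 0 ≤ maxIntegral h g - integralDual ν g := sub_nonneg.2 (integralDual_le_maxIntegral hνi)
  linarith

end BishopPhelps

end ErgodicOptimization

/-! ### Milman-type separation of ergodic measures from compact sets -/

lemma isCompact_convexJoin {E : Type*} [AddCommGroup E] [Module ℝ E] [TopologicalSpace E]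
    [ContinuousAdd E] [ContinuousSMul ℝ E] {s t : Set E} (hs : IsCompact s) (ht : IsCompact t) :
    IsCompact (convexJoin ℝ s t) := by
  have : convexJoin ℝ s t =
      (fun p : ℝ × E × E => (1 - p.1) • p.2.1 + p.1 • p.2.2) '' (Set.Icc 0 1 ×ˢ s ×ˢ t) := by
    ext x
    simp only [mem_convexJoin, segment_eq_image, Set.mem_image, Prod.exists, Set.mem_prod]
    grind
  rw [this]
  exact (isCompact_Icc.prod (hs.prod ht)).image (by fun_prop)

namespace ErgodicOptimization

section Milman

variable {K : Type*} [MetricSpace K] [CompactSpace K] [MeasurableSpace K] [BorelSpace K]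
  {h : K → K}

lemma isCompact_image_halfSpace (hh : Continuous h) (φ : C(K, ℝ)) (c : ℝ) :
    IsCompact (integralDual '' {μ | μ ∈ invariantMeasures h ∧ c ≤ integralDual μ φ}) :=
  (((isClosed_invariantMeasures hh).inter (isClosed_le continuous_const
    (continuous_integralDual_apply φ))).isCompact).image continuous_integralDual

lemma convex_image_halfSpace (hh : Continuous h) (φ : C(K, ℝ)) (c : ℝ) :
    Convex ℝ (integralDual '' {μ | μ ∈ invariantMeasures h ∧ c ≤ integralDual μ φ}) := by
  rintro _ ⟨μ, hμ, rfl⟩ _ ⟨ν, hν, rfl⟩ a b ha hb hab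
  refine ⟨convexComb a b ha hb hab μ ν,
    ⟨convexComb_mem_invariantMeasures hh ha hb hab hμ.1 hν.1, ?_⟩,
    integralDual_convexComb ha hb hab μ ν⟩
  rw [integralDual_convexComb]
  change c ≤ a * integralDual μ φ + b * integralDual ν φ
  have h₁ := mul_le_mul_of_nonneg_left hμ.2 ha
  have h₂ := mul_le_mul_of_nonneg_left hν.2 hb
  have h₃ : a * c + b * c = c := by rw [← add_mul, hab, one_mul]
  linarith

/-- A compact set of invariant measures avoiding the ergodic measure `ν` is contained in a compact
convex set of invariant measures avoiding `ν`. -/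
lemma exists_convex_compact_superset (hh : Continuous h) {F : Set (ProbabilityMeasure K)}
    (hF : IsCompact F) (hFi : F ⊆ invariantMeasures h) {ν : ProbabilityMeasure K}
    (hν : ν ∈ ergodicMeasures h) (hνF : ν ∉ F) :
    ∃ D : Set (WeakDual ℝ C(K, ℝ)), IsCompact D ∧ Convex ℝ D ∧
      D ⊆ integralDual '' invariantMeasures h ∧ integralDual ν ∉ D ∧ integralDual '' F ⊆ D := by
  refine hF.induction_on (p := fun s => ∃ D : Set (WeakDual ℝ C(K, ℝ)), IsCompact D ∧ Convex ℝ D ∧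
      D ⊆ integralDual '' invariantMeasures h ∧ integralDual ν ∉ D ∧ integralDual '' s ⊆ D)
    ⟨∅, by simp [convex_empty]⟩ ?_ ?_ ?_
  · rintro s t hst ⟨D, hc, hv, hi, hn, hs⟩
    exact ⟨D, hc, hv, hi, hn, (Set.image_mono hst).trans hs⟩
  · rintro s t ⟨D₁, hc₁, hv₁, hi₁, hn₁, hs₁⟩ ⟨D₂, hc₂, hv₂, hi₂, hn₂, hs₂⟩
    rcases D₁.eq_empty_or_nonempty with rfl | hne₁
    · exact ⟨D₂, hc₂, hv₂, hi₂, hn₂, by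
        rw [Set.image_union]; exact Set.union_subset (hs₁.trans (Set.empty_subset _)) hs₂⟩
    rcases D₂.eq_empty_or_nonempty with rfl | hne₂
    · exact ⟨D₁, hc₁, hv₁, hi₁, hn₁, by
        rw [Set.image_union]; exact Set.union_subset hs₁ (hs₂.trans (Set.empty_subset _))⟩
    -- Compactness induction: joining two admissible sets does not capture ν, because ν is not a
    -- proper convex combination of invariant measures.
    refine ⟨convexJoin ℝ D₁ D₂, isCompact_convexJoin hc₁ hc₂, hv₁.convexJoin hv₂, ?_, ?_, ?_⟩
    · intro x hx
      obtain ⟨y, hy, z, hz, a, b, ha, hb, hab, rfl⟩ := mem_convexJoin.1 hx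
      obtain ⟨μ₁, hμ₁, rfl⟩ := hi₁ hy
      obtain ⟨μ₂, hμ₂, rfl⟩ := hi₂ hz
      exact ⟨_, convexComb_mem_invariantMeasures hh ha hb hab hμ₁ hμ₂,
        integralDual_convexComb ha hb hab μ₁ μ₂⟩
    · intro hx
      obtain ⟨y, hy, z, hz, a, b, ha, hb, hab, he⟩ := mem_convexJoin.1 hx
      obtain ⟨μ₁, hμ₁, rfl⟩ := hi₁ hy
      obtain ⟨μ₂, hμ₂, rfl⟩ := hi₂ hz
      rcases ha.eq_or_lt with rfl | ha'
      · obtain rfl : b = 1 := by linarith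
        rw [zero_smul, one_smul, zero_add] at he
        exact hn₂ (he ▸ hz)
      · exact hn₁ (eq_of_convexComb_eq_ergodic ha' hb hab hν hμ₁ he ▸ hy)
    · rw [Set.image_union]
      exact Set.union_subset (hs₁.trans (subset_convexJoin_left hne₂))
        (hs₂.trans (subset_convexJoin_right hne₁))
  · intro μ hμ
    have hne : μ ≠ ν := fun e => hνF (e ▸ hμ)
    obtain ⟨φ, hφ⟩ : ∃ φ : C(K, ℝ), integralDual ν φ < integralDual μ φ := by
      by_contra! H
      refine hne (integralDual_injective (DFunLike.ext _ _ fun φ => le_antisymm (H φ) ?_))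
      simpa using H (-φ)
    -- Locally, a closed half-space {c ≤ ∫ φ} of invariant measures contains a neighbourhood of μ in
    -- F and misses ν.
    obtain ⟨c, hc, hc'⟩ := exists_between hφ
    refine ⟨F ∩ {μ | c < integralDual μ φ}, inter_mem_nhdsWithin F
      ((isOpen_lt continuous_const (continuous_integralDual_apply φ)).mem_nhds hc'),
      _, isCompact_image_halfSpace hh φ c, convex_image_halfSpace hh φ c,
      Set.image_mono fun μ hμ => hμ.1, ?_, Set.image_mono fun μ hμ => ⟨hFi hμ.1, le_of_lt hμ.2⟩⟩
    rintro ⟨μ', ⟨-, hμ'⟩, he⟩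
    rw [he] at hμ'
    linarith

/-- An ergodic measure is strictly separated by a continuous function from any compact set of
invariant measures not containing it. -/
lemma exists_separating_function (hh : Continuous h) {F : Set (ProbabilityMeasure K)}
    (hF : IsCompact F) (hFi : F ⊆ invariantMeasures h) {ν : ProbabilityMeasure K}
    (hν : ν ∈ ergodicMeasures h) (hνF : ν ∉ F) :
    ∃ ψ : C(K, ℝ), ∀ μ ∈ F, integralDual μ ψ < integralDual ν ψ := by
  obtain ⟨D, hc, hv, -, hn, hs⟩ := exists_convex_compact_superset hh hF hFi hν hνF
  obtain ⟨f, u, hu, hu'⟩ := geometric_hahn_banach_closed_point hv hc.isClosed hn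
  obtain ⟨ψ, hψ⟩ := exists_eq_eval f
  simp only [hψ] at hu hu'
  exact ⟨ψ, fun μ hμ => (hu _ (hs ⟨μ, hμ, rfl⟩)).trans hu'⟩

end Milman

/-! ### Generic maximizing measures lie in prescribed open sets -/

section Generic

variable {K : Type*} [MetricSpace K] [CompactSpace K] [MeasurableSpace K] [BorelSpace K]
  {h : K → K}

lemma closure_ergodicMeasures_subset (hh : Continuous h) :
    closure (ergodicMeasures h) ⊆ invariantMeasures h :=
  closure_minimal (fun _ hμ => Ergodic.toMeasurePreserving hμ) (isClosed_invariantMeasures hh)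

/-- If the ergodic measures in the open set `U` are dense among the ergodic measures, then for
a dense set of `φ` all maximizing measures in the closure of the ergodic measures lie in `U`. -/
lemma dense_compl_exists_maximizing_not_mem [Nonempty K] (hh : Continuous h)
    {U : Set (ProbabilityMeasure K)} (hU : IsOpen U)
    (hdense : ergodicMeasures h ⊆ closure (U ∩ ergodicMeasures h)) :
    Dense {φ : C(K, ℝ) | ∃ μ ∈ maximizingMeasures h φ, μ ∈ closure (ergodicMeasures h) \ U}ᶜ := by
  set F := closure (ergodicMeasures h) \ U with hFdef
  have hF : IsClosed F := isClosed_closure.sdiff hU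
  rw [← interior_eq_empty_iff_dense_compl, Set.eq_empty_iff_forall_notMem]
  intro φ₀ hφ₀
  set B := interior {φ : C(K, ℝ) | ∃ μ ∈ maximizingMeasures h φ, μ ∈ F}
  have hB : IsOpen B := isOpen_interior
  obtain ⟨R, -, hR, hRu⟩ := exists_residual_unique_maximizing hh
  obtain ⟨φ, hφB, hφR⟩ := hR.inter_open_nonempty B hB ⟨φ₀, hφ₀⟩
  obtain ⟨μ, hμ⟩ := hRu φ hφR
  have hμm : μ ∈ maximizingMeasures h φ := hμ ▸ Set.mem_singleton μ
  obtain ⟨r, hr, hball⟩ := Metric.isOpen_iff.1 hB φ hφB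
  obtain ⟨ν, hνφ, hνU, hνe⟩ := mem_closure_iff.1
    (hdense (ergodic_of_maximizingMeasures_eq_singleton hμ))
    {ν | maxIntegral h φ - r / 2 < integralDual ν φ}
    (isOpen_lt continuous_const (continuous_integralDual_apply φ))
    (by rw [Set.mem_ofPred_eq, integralDual_eq_maxIntegral hμm]; linarith)
  have hνφ' : maxIntegral h φ - r / 2 < integralDual ν φ := hνφ
  obtain ⟨g, hg, hνg⟩ := exists_near_maximized_by_ergodic hh hνe φ
  have hgB : g ∈ B := hball (by rw [Metric.mem_ball, dist_comm]; linarith)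
  obtain ⟨ψ, hψ⟩ := exists_separating_function hh hF.isCompact
    (Set.sdiff_subset.trans (closure_ergodicMeasures_subset hh)) hνe (fun hνF => hνF.2 hνU)
  have ht : Tendsto (fun t : ℝ => g + t • ψ) (𝓝[>] 0) (𝓝 g) := by
    have := (continuous_add_smul g ψ).tendsto 0
    simp only [zero_smul, add_zero] at this
    exact this.mono_left nhdsWithin_le_nhds
  obtain ⟨t, htB, ht0⟩ := ((ht.eventually (hB.mem_nhds hgB)).and self_mem_nhdsWithin).exists
  obtain ⟨μ', hμ', hμF⟩ := interior_subset htB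
  have h1 := integralDual_le_of_mem_maximizingMeasures hμ' hνg.1
  have h2 := integralDual_le_of_mem_maximizingMeasures hνg hμ'.1
  simp only [map_add, map_smul, smul_eq_mul] at h1
  have h3 := mul_lt_mul_of_pos_left (hψ μ' hμF) ht0
  -- The measure μ' maximizes g + tψ, yet ν is at least as good for g and strictly better for ψ.
  linarith

/-- If `U n` are open sets in each of which the ergodic measures are dense among the ergodic
measures, then for generic `φ` the maximizing measure is unique and lies in all of them. -/
theorem exists_residual_unique_maximizing_mem [Nonempty K] (hh : Continuous h)
    {U : ℕ → Set (ProbabilityMeasure K)} (hU : ∀ n, IsOpen (U n))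
    (hdense : ∀ n, ergodicMeasures h ⊆ closure (U n ∩ ergodicMeasures h)) :
    ∃ R : Set C(K, ℝ), IsGδ R ∧ Dense R ∧ ∀ φ ∈ R, ∃ μ : ProbabilityMeasure K,
      maximizingMeasures h φ = {μ} ∧ μ ∈ ergodicMeasures h ∧ ∀ n, μ ∈ U n := by
  obtain ⟨R, hRδ, hRd, hR⟩ := exists_residual_unique_maximizing hh
  let A : ℕ → Set C(K, ℝ) := fun n =>
    {φ | ∃ μ ∈ maximizingMeasures h φ, μ ∈ closure (ergodicMeasures h) \ U n}ᶜ
  have hA : ∀ n, IsOpen (A n) := fun n =>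
    (isClosed_setOf_exists_maximizing_mem hh (isClosed_closure.sdiff (hU n))).isOpen_compl
  have hAδ : IsGδ (⋂ n, A n) := IsGδ.iInter_of_isOpen hA
  have hAd : Dense (⋂ n, A n) := dense_iInter_of_isOpen hA fun n =>
    dense_compl_exists_maximizing_not_mem hh (hU n) (hdense n)
  refine ⟨R ∩ ⋂ n, A n, hRδ.inter hAδ, hRd.inter_of_Gδ hRδ hAδ hAd, ?_⟩
  rintro φ ⟨hφR, hφA⟩
  obtain ⟨μ, hμ⟩ := hR φ hφR
  have hμe := ergodic_of_maximizingMeasures_eq_singleton hμ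
  refine ⟨μ, hμ, hμe, fun n => ?_⟩
  by_contra hn
  exact Set.mem_iInter.1 hφA n ⟨μ, hμ ▸ Set.mem_singleton μ, subset_closure hμe, hn⟩

end Generic

/-! ### Periodic measures are ergodic with zero entropy -/

section Periodic

variable {K : Type*} [MetricSpace K] [CompactSpace K] [MeasurableSpace K] [BorelSpace K]
  {h : K → K}

lemma orbitAverage_apply (h : K → K) (x : K) (n : ℕ) (s : Set K) :
    ((n : ℝ≥0∞)⁻¹ • ∑ i ∈ Finset.range n, Measure.dirac (h^[i] x)) s =
      (n : ℝ≥0∞)⁻¹ * ∑ i ∈ Finset.range n, s.indicator (1 : K → ℝ≥0∞) (h^[i] x) := by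
  simp [Measure.finsetSum_apply]

lemma periodicMeasures_subset_ergodicMeasures (hh : Continuous h) :
    periodicMeasures h ⊆ ergodicMeasures h := by
  rintro μ ⟨x, hx, hμ⟩
  set p := Function.minimalPeriod h x with hp
  have hp0 : 0 < p := Function.minimalPeriod_pos_of_mem_periodicPts hx
  have hinv : μ ∈ invariantMeasures h := by
    rw [mem_invariantMeasures_iff hh]
    intro φ
    rw [integralDual_apply, integralDual_apply, hμ, integral_orbitAverage, integral_orbitAverage]
    have h1 := Finset.sum_range_succ (fun i => φ (h^[i] x)) p
    have h2 := Finset.sum_range_succ' (fun i => φ (h^[i] x)) p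
    have h3 : h^[p] x = x := Function.iterate_minimalPeriod
    simp only [h3, Function.iterate_zero, id_eq] at h1 h2
    congr 1
    simp only [ContinuousMap.comp_apply, ContinuousMap.coe_mk, ← Function.iterate_succ_apply' h]
    linarith
  refine ⟨hinv, ⟨fun s hs hsi => ?_⟩⟩
  have hiter : ∀ i, h^[i] x ∈ s ↔ x ∈ s := by
    intro i
    induction i with
    | zero => rfl
    | succ i ih =>
      rw [Function.iterate_succ_apply', ← ih]
      exact Set.ext_iff.1 hsi (h^[i] x)
  rw [eventuallyConst_set']
  by_cases hxs : x ∈ s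
  · right
    rw [ae_eq_univ, hμ, orbitAverage_apply]
    simp [hiter, hxs]
  · left
    rw [ae_eq_empty, hμ, orbitAverage_apply]
    simp [hiter, hxs]

lemma negMulLog_le_one {x : ℝ} (hx : 0 ≤ x) : Real.negMulLog x ≤ 1 := by
  rcases hx.eq_or_lt with rfl | hx
  · simp
  · have h1 := Real.log_le_sub_one_of_pos (inv_pos.2 hx)
    rw [Real.log_inv] at h1
    have h2 := mul_le_mul_of_nonneg_left h1 hx.le
    rw [mul_sub, mul_inv_cancel₀ hx.ne'] at h2
    rw [Real.negMulLog]
    linarith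

/-- At most n cells are charged and each contributes at most 1. The crude bound suffices because it
does not depend on the partition, so dividing by the itinerary length sends it to 0. -/
lemma partitionEntropy_orbitAverage_le {ι : Type*} [Fintype ι] (h : K → K) (x : K) (n : ℕ)
    (ξ : K → ι) :
    partitionEntropy ((n : ℝ≥0∞)⁻¹ • ∑ i ∈ Finset.range n, Measure.dirac (h^[i] x)) ξ ≤ n := by
  classical
  set μ := (n : ℝ≥0∞)⁻¹ • ∑ i ∈ Finset.range n, Measure.dirac (h^[i] x)
  let T : Finset ι := (Finset.range n).image fun i => ξ (h^[i] x)
  have hzero : ∀ a ∉ T, Real.negMulLog (μ.real (ξ ⁻¹' {a})) = 0 := by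
    intro a ha
    have : μ (ξ ⁻¹' {a}) = 0 := by
      rw [orbitAverage_apply, Finset.sum_eq_zero, mul_zero]
      intro i hi
      refine Set.indicator_of_notMem (fun hmem => ha ?_) _
      exact Finset.mem_image.2 ⟨i, hi, hmem⟩
    simp [measureReal_def, this]
  calc partitionEntropy μ ξ = ∑ a ∈ T, Real.negMulLog (μ.real (ξ ⁻¹' {a})) :=
        (Finset.sum_subset (Finset.subset_univ T) fun a _ => hzero a).symm
    _ ≤ ∑ a ∈ T, 1 := Finset.sum_le_sum fun a _ => negMulLog_le_one measureReal_nonneg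
    _ = T.card := by simp
    _ ≤ n := by exact_mod_cast Finset.card_image_le.trans (Finset.card_range n).le

lemma metricEntropy_periodicMeasure {μ : ProbabilityMeasure K} (hμ : μ ∈ periodicMeasures h) :
    metricEntropy h (μ : Measure K) = 0 := by
  obtain ⟨x, -, hμ⟩ := hμ
  simp only [metricEntropy, ENNReal.iSup_eq_zero]
  intro k ξ _
  set p := Function.minimalPeriod h x
  refine Tendsto.limsup_eq (tendsto_of_tendsto_of_tendsto_of_le_of_le tendsto_const_nhds
    (h := fun n : ℕ => ENNReal.ofReal (p / n)) ?_ (fun _ => zero_le) fun n => ?_)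
  · simpa using ENNReal.tendsto_ofReal (tendsto_const_div_atTop_nhds_zero_nat (p : ℝ))
  · refine ENNReal.ofReal_le_ofReal ?_
    gcongr
    rw [hμ]
    exact partitionEntropy_orbitAverage_le h x p _

end Periodic

/-! ### Zero entropy and full support -/

section Residual

variable {K : Type*} [MetricSpace K] [CompactSpace K] [MeasurableSpace K] [BorelSpace K]
  {h : K → K}

/-- The space of probability measures is metrizable here, so the sequential semicontinuity in
`PropertyS` suffices. -/
lemma isClosed_setOf_le_metricEntropy (hh : Continuous h) (hS : PropertyS h) (c : ℝ≥0∞) :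
    IsClosed {μ : ProbabilityMeasure K |
      μ ∈ invariantMeasures h ∧ c ≤ metricEntropy h (μ : Measure K)} := by
  refine IsSeqClosed.isClosed fun ν μ hν hμ => ?_
  refine ⟨(isClosed_invariantMeasures hh).mem_of_tendsto hμ
    (Eventually.of_forall fun n => (hν n).1), le_trans ?_ (hS ν μ (fun n => (hν n).1) hμ)⟩
  exact (le_liminf_of_le (by isBoundedDefault) (Eventually.of_forall fun n => (hν n).2)).trans
    liminf_le_limsup

theorem exists_residual_zero_entropy [Nonempty K] (hh : Continuous h) (hP : PropertyPePlus h)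
    (hS : PropertyS h) : ∃ R : Set C(K, ℝ), IsGδ R ∧ Dense R ∧
      ∀ φ ∈ R, ∃ μ : ProbabilityMeasure K, maximizingMeasures h φ = {μ} ∧
        metricEntropy h (μ : Measure K) = 0 := by
  let U : ℕ → Set (ProbabilityMeasure K) := fun n =>
    {μ | μ ∈ invariantMeasures h ∧ (n : ℝ≥0∞)⁻¹ ≤ metricEntropy h (μ : Measure K)}ᶜ
  have hzero : ∀ n (μ : ProbabilityMeasure K), metricEntropy h (μ : Measure K) = 0 → μ ∈ U n := by
    rintro n μ h0 ⟨-, hle⟩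
    rw [h0] at hle
    exact ENNReal.natCast_ne_top n (ENNReal.inv_eq_zero.1 (le_zero_iff.1 hle))
  obtain ⟨R, hRδ, hRd, hR⟩ := exists_residual_unique_maximizing_mem hh (U := U)
    (fun n => (isClosed_setOf_le_metricEntropy hh hS _).isOpen_compl) (fun n μ hμ => by
      rcases eq_or_ne (metricEntropy h (μ : Measure K)) 0 with h0 | h0
      · exact subset_closure ⟨hzero n μ h0, hμ⟩
      · have hsub : periodicMeasures h ⊆ U n ∩ ergodicMeasures h := fun ν hν =>
          ⟨hzero n ν (metricEntropy_periodicMeasure hν),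
            periodicMeasures_subset_ergodicMeasures hh hν⟩
        exact closure_mono hsub (hP μ hμ (pos_iff_ne_zero.2 h0)))
  refine ⟨R, hRδ, hRd, fun φ hφ => ?_⟩
  obtain ⟨μ, hμ, hμe, hμU⟩ := hR φ hφ
  refine ⟨μ, hμ, ?_⟩
  by_contra h0
  obtain ⟨n, hn⟩ := ENNReal.exists_inv_nat_lt h0
  exact hμU n ⟨Ergodic.toMeasurePreserving hμe, hn.le⟩

theorem exists_residual_full_support [Nonempty K] (hh : Continuous h) (hF : PropertyFs h) :
    ∃ R : Set C(K, ℝ), IsGδ R ∧ Dense R ∧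
      ∀ φ ∈ R, ∃ μ : ProbabilityMeasure K, maximizingMeasures h φ = {μ} ∧
        (μ : Measure K).support = Set.univ := by
  obtain ⟨R, hRδ, hRd, hR⟩ := hF
  obtain ⟨V, hVo, rfl⟩ := hRδ.eq_iInter_nat
  choose U hUo hUV using fun n => isOpen_induced_iff.1 (hVo n)
  obtain ⟨R', hδ, hd, hR'⟩ := exists_residual_unique_maximizing_mem hh hUo (fun n μ hμ => by
    rw [mem_closure_iff]
    intro W hW hμW
    obtain ⟨⟨ν, hν⟩, hνW, hνV⟩ := hRd.inter_open_nonempty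
      (Subtype.val ⁻¹' W)
      (hW.preimage continuous_subtype_val) ⟨⟨μ, subset_closure hμ⟩, hμW⟩
    have hνU := Set.mem_iInter.1 hνV n
    rw [← hUV] at hνU
    -- The point ν of the dense G_δ is only a limit of ergodic measures; openness of W ∩ U n lets an
    -- ergodic ρ replace it.
    obtain ⟨ρ, ⟨hρW, hρU⟩, hρ⟩ := mem_closure_iff.1 hν (W ∩ U n) (hW.inter (hUo n)) ⟨hνW, hνU⟩
    exact ⟨ρ, hρW, hρU, hρ⟩)
  refine ⟨R', hδ, hd, fun φ hφ => ?_⟩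
  obtain ⟨μ, hμ, hμe, hμU⟩ := hR' φ hφ
  refine ⟨μ, hμ, hR ⟨μ, subset_closure hμe⟩ (Set.mem_iInter.2 fun n => ?_)⟩
  rw [← hUV]
  exact hμU n

end Residual

end ErgodicOptimization
theorem theoremD {K : Type*} [MetricSpace K] [CompactSpace K] [Nonempty K]
    [MeasurableSpace K] [BorelSpace K] (h : K ≃ₜ K) :
    (∃ R₁ : Set C(K, ℝ), IsGδ R₁ ∧ Dense R₁ ∧
      ∀ φ ∈ R₁, ∃ μ : ProbabilityMeasure K,
        ErgodicOptimization.maximizingMeasures h φ = {μ}) ∧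
    (ErgodicOptimization.PropertyPePlus h → ErgodicOptimization.PropertyS h →
      ∃ R₂ : Set C(K, ℝ), IsGδ R₂ ∧ Dense R₂ ∧
        ∀ φ ∈ R₂, ∃ μ : ProbabilityMeasure K,
          ErgodicOptimization.maximizingMeasures h φ = {μ} ∧
            ErgodicOptimization.metricEntropy h (μ : Measure K) = 0) ∧
    (ErgodicOptimization.PropertyFs h →
      ∃ R₃ : Set C(K, ℝ), IsGδ R₃ ∧ Dense R₃ ∧
        ∀ φ ∈ R₃, ∃ μ : ProbabilityMeasure K,
          ErgodicOptimization.maximizingMeasures h φ = {μ} ∧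
            (μ : Measure K).support = Set.univ) :=
  ⟨ErgodicOptimization.exists_residual_unique_maximizing h.continuous,
    ErgodicOptimization.exists_residual_zero_entropy h.continuous,
    ErgodicOptimization.exists_residual_full_support h.continuous⟩
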